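/- Let $m,n\ge 0$, let $R$ be a commutative ring, and let $X=(x_{ij})$ be a generic $m\times n$ matrix over $R$, i.e. its entries are distinct indeterminates of a polynomial ring with coefficients in $R$. For $A\subseteq\{1,\dots,m\}$ and $B\subseteq\{1,\dots,n\}$ with $|A|=|B|$, let $(A|B)$ denote the minor of $X$ with row indices in $A$ and column indices in $B$ (so $(\emptyset|\emptyset)=1$). For finite sets of positive integers $S=\{s_1<\dots<s_p\}$ and $T=\{t_1<\dots<t_q\}$, write $S\le T$ if $p\ge q$ and $s_\nu\le t_\nu$ for all $\nu\le q$. A standard monomial in the minors of $X$ is a product $(A_1|B_1)\cdots(A_r|B_r)$, with $r\ge 0$ and $|A_i|=|B_i|$ for all $i$, such that $A_1\le A_2\le\dots\le A_r$ and $B_1\le B_2\le\dots\le B_r$; two standard monomials whose sequences of pairs $(A_i,B_i)$ differ only by factors of the form $(\emptyset|\emptyset)$ are regarded as identical. Then the standard monomials in the minors of $X$, as a family indexed by the sequences $((A_1,B_1),\dots,(A_r,B_r))$ up to this identification, are linearly independent over $R$. -/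

import Mathlib

namespace Straightening

/-- The partial order on subsets of `{1, …, n}`: for `S = {s₁ < ⋯ < s_p}` and `T = {t₁ < ⋯ < t_q}`,
`S ≤ T` means that `p ≥ q` and `s_ν ≤ t_ν` for all `ν ≤ q`. -/
def SubsetLE {n : ℕ} (S T : Finset (Fin n)) : Prop :=
  ∃ h : T.card ≤ S.card, ∀ ν : Fin T.card,
    S.orderEmbOfFin rfl (Fin.castLE h ν) ≤ T.orderEmbOfFin rfl ν

/-- The minor `X(A|B)`, the determinant of the submatrix of `X` with rows in `A` and columns in `B`
(both taken in increasing order); it is `0` if `|A| ≠ |B|`. -/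
def minor {m n : ℕ} {K : Type*} [CommRing K] (X : Matrix (Fin m) (Fin n) K)
    (A : Finset (Fin m)) (B : Finset (Fin n)) : K :=
  if h : B.card = A.card then
    (X.submatrix (A.orderEmbOfFin rfl) (B.orderEmbOfFin h)).det
  else 0

/-- A standard sequence `(A₁, B₁), …, (A_r, B_r)`: `|A_i| = |B_i|` for all `i`,
`A₁ ≤ ⋯ ≤ A_r` and `B₁ ≤ ⋯ ≤ B_r`. -/
structure StandardSeq (m n : ℕ) where
  /-- the sequence of pairs `(A_i, B_i)` -/
  factors : List (Finset (Fin m) × Finset (Fin n))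
  card_eq : ∀ P ∈ factors, P.1.card = P.2.card
  rows_le : (factors.map Prod.fst).IsChain SubsetLE
  cols_le : (factors.map Prod.snd).IsChain SubsetLE

/-- The list of the factors of a standard sequence other than `(∅|∅)`. -/
def StandardSeq.nonemptyFactors {m n : ℕ} (s : StandardSeq m n) :
    List (Finset (Fin m) × Finset (Fin n)) :=
  s.factors.filter (fun P => P ≠ (∅, ∅))

/-- The product `X(A₁|B₁) ⋯ X(A_r|B_r)`. -/
def StandardSeq.eval {m n : ℕ} {K : Type*} [CommRing K] (X : Matrix (Fin m) (Fin n) K)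
    (s : StandardSeq m n) : K :=
  (s.factors.map (fun P => minor X P.1 P.2)).prod

/-- Two standard sequences are identified if they differ only by factors `(∅|∅)`. -/
instance StandardSeq.setoid (m n : ℕ) : Setoid (StandardSeq m n) where
  r s t := s.nonemptyFactors = t.nonemptyFactors
  iseqv := ⟨fun _ => rfl, fun h => h.symm, fun h h' => h.trans h'⟩

/-- The (formal) standard monomials in the minors of an `m × n` matrix: standard sequences up to
factors `(∅|∅)`. -/
def StandardMonomial (m n : ℕ) : Type := Quotient (StandardSeq.setoid m n)

theorem minor_empty {m n : ℕ} {K : Type*} [CommRing K] (X : Matrix (Fin m) (Fin n) K) :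
    minor X ∅ ∅ = 1 := by
  unfold minor
  rw [dif_pos (by simp)]
  exact Matrix.det_fin_zero

theorem StandardSeq.eval_eq {m n : ℕ} {K : Type*} [CommRing K] (X : Matrix (Fin m) (Fin n) K)
    (s : StandardSeq m n) :
    s.eval X = (s.nonemptyFactors.map (fun P => minor X P.1 P.2)).prod := by
  unfold StandardSeq.eval StandardSeq.nonemptyFactors
  induction s.factors with
  | nil => rfl
  | cons P l ih =>
    by_cases hP : P = (∅, ∅)
    · subst hP
      simpa [minor_empty] using ih
    · rw [List.filter_cons_of_pos (by simpa using hP), List.map_cons, List.prod_cons,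
        List.map_cons, List.prod_cons, ih]

/-- The element of `K` given by a standard monomial in the minors of a matrix `X` over `K`. -/
def StandardMonomial.eval {m n : ℕ} {K : Type*} [CommRing K] (X : Matrix (Fin m) (Fin n) K) :
    StandardMonomial m n → K :=
  Quotient.lift (StandardSeq.eval X) (fun s t (h : s.nonemptyFactors = t.nonemptyFactors) => by
    rw [StandardSeq.eval_eq, StandardSeq.eval_eq, h])

/-- A generic matrix: its entries are distinct indeterminates of a polynomial ring. -/
def IsGeneric {m n : ℕ} {R σ : Type*} [CommRing R]
    (X : Matrix (Fin m) (Fin n) (MvPolynomial σ R)) : Prop :=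
  ∃ x : Fin m × Fin n → σ, Function.Injective x ∧ ∀ i j, X i j = MvPolynomial.X (x (i, j))

end Straightening

/-!
Substitute for the generic matrix `X` the product `P * Q` of two generic matrices of sizes
`m × k` and `k × n`, where `k = m + n`. Expanding along the rows,
`(A|B)(P * Q) = ∑_f (∏ᵢ P (aᵢ) (f i)) * det (Q (f i) (bⱼ))`, and only injective `f` contribute.
Order the variables of `P` before those of `Q`, and within each of the two matrices compare the
summation index before the row index (for `P`) or the column index (for `Q`). For the lexicographic monomial order, the leading
monomial of `(A|B)(P * Q)` is then `∏ᵢ P (aᵢ) i * Q i (bᵢ)`, with coefficient `1`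
(`isMonicOfDegree_det_mul`): the first index `i` with `f i ≠ i` has `f i > i`, and the variable
`P (aᵢ) i` is lost (`toLex_exponent_lt`).

Hence the leading monomial of a product of minors lists, for every `i`, the multiset of `i`-th
elements of the row sets and that of the column sets. If the product is standard, the first factor
has, for each `i`, the smallest of these elements, so that it can be read off from the
leading monomial (`pairLE_of_sum_eq`). By induction a standard sequence without factors
`(∅|∅)` is determined by its leading monomial (`list_eq_of_sum_leadingExponent_eq`), and polynomials
with distinct leading monomials and leading coefficients `1` are linearly independent.
-/

namespace Straightening

open MvPolynomial MonomialOrder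

/-! ### Polynomials with a given leading monomial -/

/-- The polynomial `p` has the leading monomial `d`, with coefficient `1`. Over the zero ring this
holds for all `p` and `d`. -/
structure IsMonicOfDegree {τ R : Type*} [CommRing R] (o : MonomialOrder τ)
    (p : MvPolynomial τ R) (d : τ →₀ ℕ) : Prop where
  coeff_eq_one : p.coeff d = 1
  degree_le : o.degree p ≼[o] d

namespace IsMonicOfDegree

variable {τ R : Type*} [CommRing R] {o : MonomialOrder τ}

theorem one : IsMonicOfDegree o (1 : MvPolynomial τ R) 0 :=
  ⟨by simp, by simp⟩

theorem mul {p q : MvPolynomial τ R} {d e : τ →₀ ℕ} (hp : IsMonicOfDegree o p d)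
    (hq : IsMonicOfDegree o q e) : IsMonicOfDegree o (p * q) (d + e) := by
  refine ⟨?_, ?_⟩
  · rw [o.coeff_mul_of_add_of_degree_le hp.degree_le hq.degree_le, hp.coeff_eq_one,
      hq.coeff_eq_one, one_mul]
  · refine o.degree_mul_le.trans ?_
    rw [map_add, map_add]
    exact add_le_add hp.degree_le hq.degree_le

theorem list_prod {ι : Type*} {p : ι → MvPolynomial τ R} {d : ι → τ →₀ ℕ} (l : List ι)
    (h : ∀ i ∈ l, IsMonicOfDegree o (p i) (d i)) :
    IsMonicOfDegree o (l.map p).prod (l.map d).sum := by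
  induction l with
  | nil => exact one
  | cons i l ih =>
    rw [List.map_cons, List.prod_cons, List.map_cons, List.sum_cons]
    exact (h i (by simp)).mul (ih fun j hj => h j (by simp [hj]))

theorem coeff_eq_zero {p : MvPolynomial τ R} {d e : τ →₀ ℕ} (hp : IsMonicOfDegree o p d)
    (h : d ≺[o] e) : p.coeff e = 0 :=
  o.coeff_eq_zero_of_lt (hp.degree_le.trans_lt h)

theorem sum_monomial {ι : Type*} (s : Finset ι) (c : ι → R) (e : ι → τ →₀ ℕ) {i₀ : ι}
    (hi₀ : i₀ ∈ s) (hc : c i₀ = 1) (he : ∀ i ∈ s, i ≠ i₀ → e i ≺[o] e i₀) :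
    IsMonicOfDegree o (∑ i ∈ s, monomial (e i) (c i)) (e i₀) := by
  classical
  refine ⟨?_, ?_⟩
  · rw [coeff_sum, Finset.sum_eq_single i₀, coeff_monomial, if_pos rfl, hc]
    · intro i hi hne
      rw [coeff_monomial, if_neg]
      intro h
      exact (he i hi hne).ne (by rw [h])
    · exact fun h => absurd hi₀ h
  · rw [o.degree_le_iff]
    intro b hb
    obtain ⟨i, hi, hbi⟩ := Finset.mem_biUnion.1 (support_sum hb)
    have hbi := Finset.mem_singleton.1 (support_monomial_subset hbi)
    subst hbi
    by_cases h : i = i₀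
    · rw [h]
    · exact (he i hi h).le

/-- Polynomials with distinct leading monomials, all with leading coefficient `1`, are linearly
independent. -/
theorem linearIndependent {ι : Type*} {p : ι → MvPolynomial τ R} {d : ι → τ →₀ ℕ}
    (hp : ∀ i, IsMonicOfDegree o (p i) (d i)) (hd : Function.Injective d) :
    LinearIndependent R p := by
  rw [linearIndependent_iff]
  intro c hc
  by_contra hne
  obtain ⟨i, hi, hmax⟩ := Finset.exists_max_image c.support (fun i => o.toSyn (d i))
    (Finsupp.support_nonempty_iff.2 hne)
  have hcoeff := congrArg (coeff (d i)) hc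
  rw [Finsupp.linearCombination_apply, Finsupp.sum, coeff_sum, coeff_zero,
    Finset.sum_eq_single i, coeff_smul, (hp i).coeff_eq_one, smul_eq_mul, mul_one] at hcoeff
  · exact Finsupp.mem_support_iff.1 hi hcoeff
  · intro j hj hji
    rw [coeff_smul, (hp j).coeff_eq_zero, smul_zero]
    exact lt_of_le_of_ne (hmax j hj) fun h => hji (hd (o.toSyn.injective h))
  · exact fun h => absurd hi h

end IsMonicOfDegree

/-! ### Exponents -/

/-- The exponent of the monomial `∏ᵢ y_{f i, a i}`, where the variable `y_{j, c}` is
named `g (j, c)`. -/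
noncomputable def exponent {τ : Type*} {k n p : ℕ} (g : Fin k ×ₗ Fin n → τ) (f : Fin p → Fin k)
    (a : Fin p → Fin n) : τ →₀ ℕ :=
  ∑ i, Finsupp.single (g (toLex (f i, a i))) 1

theorem exponent_apply_ne_zero {τ : Type*} {k n p : ℕ} {g : Fin k ×ₗ Fin n → τ}
    {f : Fin p → Fin k} {a : Fin p → Fin n} {v : τ} :
    exponent g f a v ≠ 0 ↔ ∃ i, g (toLex (f i, a i)) = v := by
  classical
  simp [exponent, Finsupp.finsetSum_apply, Finsupp.single_apply]

/-- Among the monomials `∏ᵢ y_{f i, a i}` with `f` injective, the one with `f i = i` for all `i`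
is the largest: at the first `i` with `f i ≠ i` the other monomial misses the variable
`y_{i, a i}`. -/
theorem toLex_exponent_lt {τ : Type*} [LinearOrder τ] {k n p : ℕ} {g : Fin k ×ₗ Fin n → τ}
    (hg : StrictMono g) (h : p ≤ k) (a : Fin p ↪o Fin n) {f : Fin p → Fin k}
    (hf : Function.Injective f) (hne : f ≠ Fin.castLE h) :
    toLex (exponent g f a) < toLex (exponent g (Fin.castLE h) a) := by
  classical
  have hex : ∃ i, f i ≠ Fin.castLE h i := by
    by_contra hcon
    push Not at hcon
    exact hne (funext hcon)
  obtain ⟨i₀, hi₀, hmin⟩ := WellFounded.has_min (wellFounded_lt (α := Fin p))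
    {i | f i ≠ Fin.castLE h i} hex
  have hlow : ∀ i < i₀, f i = Fin.castLE h i := fun i hi => by
    by_contra hcon
    exact hmin i hcon hi
  -- the values below `i₀` are already taken by the indices below `i₀`
  have hhigh : ∀ i, i₀ ≤ i → Fin.castLE h i₀ ≤ f i := by
    intro i hi
    by_contra! hlt
    have hlt' : (f i : ℕ) < i₀ := hlt
    have h1 : f ⟨f i, hlt'.trans i₀.2⟩ = f i := by
      rw [hlow _ (by exact hlt')]
      rfl
    have h2 := congrArg Fin.val (hf h1)
    have h3 : (i₀ : ℕ) ≤ i := hi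
    simp only at h2
    omega
  rw [Finsupp.Lex.lt_iff]
  refine ⟨g (toLex (Fin.castLE h i₀, a i₀)), ?_, ?_⟩
  · intro v hv
    simp only [exponent, ofLex_toLex, Finsupp.finsetSum_apply]
    refine Finset.sum_congr rfl fun i _ => ?_
    rcases lt_or_ge i i₀ with hi | hi
    · rw [hlow i hi]
    · have hai : a i₀ ≤ a i := a.monotone hi
      rw [Finsupp.single_eq_of_ne', Finsupp.single_eq_of_ne']
      · rintro rfl
        refine absurd hv (not_lt.2 (hg.monotone ?_))
        rw [Prod.Lex.toLex_le_toLex']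
        exact ⟨hi, fun _ => hai⟩
      · rintro rfl
        refine absurd hv (not_lt.2 (hg.monotone ?_))
        rw [Prod.Lex.toLex_le_toLex']
        exact ⟨hhigh i hi, fun _ => hai⟩
  · have h0 : exponent g f a (g (toLex (Fin.castLE h i₀, a i₀))) = 0 := by
      by_contra hcon
      obtain ⟨i, hi⟩ := exponent_apply_ne_zero.1 hcon
      have hi := toLex.injective (hg.injective hi)
      rw [Prod.mk.injEq] at hi
      have hii := a.injective hi.2
      exact hi₀ (hii ▸ hi.1)
    exact h0 ▸ Nat.pos_of_ne_zero (exponent_apply_ne_zero.2 ⟨i₀, rfl⟩)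

theorem toLex_exponent_le {τ : Type*} [LinearOrder τ] {k n p : ℕ} {g : Fin k ×ₗ Fin n → τ}
    (hg : StrictMono g) (h : p ≤ k) (a : Fin p ↪o Fin n) {f : Fin p → Fin k}
    (hf : Function.Injective f) :
    toLex (exponent g f a) ≤ toLex (exponent g (Fin.castLE h) a) := by
  by_cases hne : f = Fin.castLE h
  · rw [hne]
  · exact (toLex_exponent_lt hg h a hf hne).le

/-! ### Minors of a product of generic matrices -/

/-- A minor of a product as a sum over injective maps, a form of the Cauchy–Binet formula. -/
theorem det_submatrix_mul {K : Type*} [CommRing K] {m n k p : ℕ} (P : Matrix (Fin m) (Fin k) K)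
    (Q : Matrix (Fin k) (Fin n) K) (a : Fin p → Fin m) (b : Fin p → Fin n) :
    ((P * Q).submatrix a b).det =
      ∑ x ∈ (Finset.univ.filter fun f : Fin p → Fin k => Function.Injective f) ×ˢ
          (Finset.univ : Finset (Equiv.Perm (Fin p))),
        Equiv.Perm.sign x.2 •
          ((∏ i, P (a i) (x.1 i)) * ∏ i, Q (x.1 (x.2 i)) (b i)) := by
  classical
  have h1 : (P * Q).submatrix a b =
      fun i => ∑ j, P (a i) j • (fun l => Q j (b l) : Fin p → K) := by
    ext i l
    simp [Matrix.mul_apply, Finset.sum_apply]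
  have h2 : ((P * Q).submatrix a b).det = ∑ f : Fin p → Fin k,
      (∏ i, P (a i) (f i)) * (Matrix.of fun i l => Q (f i) (b l)).det := by
    rw [h1]
    change (Matrix.detRowAlternating (n := Fin p) (R := K)).toMultilinearMap _ = _
    rw [MultilinearMap.map_sum]
    refine Finset.sum_congr rfl fun f _ => ?_
    rw [MultilinearMap.map_smul_univ]
    rfl
  rw [h2, Finset.sum_product, ← Finset.sum_filter_of_ne (p := Function.Injective)]
  · refine Finset.sum_congr rfl fun f _ => ?_
    rw [Matrix.det_apply, Finset.mul_sum]
    refine Finset.sum_congr rfl fun s _ => ?_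
    rw [mul_smul_comm]
    rfl
  · -- a determinant with two equal rows vanishes
    intro f _ hne
    by_contra hf
    simp only [Function.Injective, not_forall] at hf
    obtain ⟨i, j, hij, hne'⟩ := hf
    exact hne (by rw [Matrix.det_zero_of_row_eq hne' (by ext l; simp [hij]), mul_zero])

/-- The variables of the entries of generic matrices of sizes `m × k` and `k × n`. The summation
index comes first in each pair, so that it is the first to be compared. -/
abbrev ProductVar (m n k : ℕ) : Type := (Fin k ×ₗ Fin m) ⊕ₗ (Fin k ×ₗ Fin n)

section

variable {m n k : ℕ}

/-- The generic `m × k` matrix. -/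
noncomputable def leftFactor (R : Type*) [CommRing R] (m n k : ℕ) :
    Matrix (Fin m) (Fin k) (MvPolynomial (ProductVar m n k) R) :=
  fun i j => X (Sum.inlₗ (toLex (j, i)))

/-- The generic `k × n` matrix. -/
noncomputable def rightFactor (R : Type*) [CommRing R] (m n k : ℕ) :
    Matrix (Fin k) (Fin n) (MvPolynomial (ProductVar m n k) R) :=
  fun j l => X (Sum.inrₗ (toLex (j, l)))

theorem prod_X_exponent {R τ : Type*} [CommRing R] {p : ℕ} (g : Fin k ×ₗ Fin n → τ)
    (f : Fin p → Fin k) (a : Fin p → Fin n) :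
    ∏ i, (X (g (toLex (f i, a i))) : MvPolynomial τ R) = monomial (exponent g f a) 1 := by
  rw [exponent, monomial_sum_one]
  rfl


theorem isMonicOfDegree_det_mul (R : Type*) [CommRing R] {p : ℕ} (h : p ≤ k)
    (a : Fin p ↪o Fin m) (b : Fin p ↪o Fin n) :
    IsMonicOfDegree MonomialOrder.lex
      ((leftFactor R m n k * rightFactor R m n k).submatrix a b).det
      (exponent Sum.inlₗ (Fin.castLE h) a + exponent Sum.inrₗ (Fin.castLE h) b) := by
  classical
  have key := IsMonicOfDegree.sum_monomial (R := R)
    (o := (MonomialOrder.lex : MonomialOrder (ProductVar m n k)))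
    ((Finset.univ.filter fun f : Fin p → Fin k => Function.Injective f) ×ˢ
          (Finset.univ : Finset (Equiv.Perm (Fin p))))
    (fun x => ((Equiv.Perm.sign x.2 : ℤ) : R))
    (fun x => exponent Sum.inlₗ x.1 a + exponent Sum.inrₗ (x.1 ∘ x.2) b)
    (i₀ := (Fin.castLE h, 1)) (by simp [Fin.castLE_injective]) (by simp) ?_
  · rw [det_submatrix_mul]
    convert key using 1
    swap
    · rfl
    refine Finset.sum_congr rfl fun x _ => ?_
    have h1 : ∏ i, leftFactor R m n k (a i) (x.1 i) = _ := prod_X_exponent Sum.inlₗ x.1 a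
    have h2 : ∏ i, rightFactor R m n k (x.1 (x.2 i)) (b i) = _ :=
      prod_X_exponent Sum.inrₗ (x.1 ∘ x.2) b
    rw [h1, h2, monomial_mul, one_mul, Units.smul_def, smul_monomial]
    simp
  · rintro ⟨f, s⟩ hx hne
    have hf : Function.Injective f := by simpa using hx
    rw [MonomialOrder.lex_lt_iff, toLex_add, toLex_add]
    have hl := toLex_exponent_le (Sum.Lex.inl_strictMono (α := Fin k ×ₗ Fin m)
      (β := Fin k ×ₗ Fin n)) h a hf
    have hr := toLex_exponent_le (Sum.Lex.inr_strictMono (α := Fin k ×ₗ Fin m)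
      (β := Fin k ×ₗ Fin n)) h b (hf.comp s.injective)
    by_cases hfe : f = Fin.castLE h
    · refine add_lt_add_of_le_of_lt hl (toLex_exponent_lt Sum.Lex.inr_strictMono h b
        (hf.comp s.injective) fun hcon => hne ?_)
      subst hfe
      congr 1
      ext i
      exact congrArg Fin.val (Fin.castLE_injective h (congrFun hcon i))
    · exact add_lt_add_of_lt_of_le (toLex_exponent_lt Sum.Lex.inl_strictMono h a hf hfe) hr

end

/-! ### Leading monomials of standard sequences -/

/-- The exponent of `∏ᵢ y_{i, aᵢ}` for `A = {a₀ < a₁ < ⋯}`. -/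
noncomputable def setExponent {τ : Type*} {k n : ℕ} (g : Fin k ×ₗ Fin n → τ) (h : n ≤ k)
    (A : Finset (Fin n)) : τ →₀ ℕ :=
  exponent g (Fin.castLE ((card_finset_fin_le A).trans h)) (A.orderEmbOfFin rfl)

theorem exponent_orderEmbOfFin {τ : Type*} {k n p : ℕ} (g : Fin k ×ₗ Fin n → τ) (h : n ≤ k)
    {A : Finset (Fin n)} (hp : A.card = p) (hpk : p ≤ k) :
    exponent g (Fin.castLE hpk) (A.orderEmbOfFin hp) = setExponent g h A := by
  subst hp
  rfl

theorem setExponent_apply_ne_zero {τ : Type*} {k n : ℕ} {g : Fin k ×ₗ Fin n → τ} {h : n ≤ k}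
    {A : Finset (Fin n)} {v : τ} :
    setExponent g h A v ≠ 0 ↔
      ∃ i : Fin A.card, g (toLex (Fin.castLE ((card_finset_fin_le A).trans h) i,
        A.orderEmbOfFin rfl i)) = v :=
  exponent_apply_ne_zero

/-- The exponent of the leading monomial of `(A|B)` evaluated at the product of the generic
matrices. -/
noncomputable def leadingExponent {m n : ℕ} (P : Finset (Fin m) × Finset (Fin n)) :
    ProductVar m n (m + n) →₀ ℕ :=
  setExponent Sum.inlₗ (Nat.le_add_right m n) P.1 + setExponent Sum.inrₗ (Nat.le_add_left n m) P.2

theorem isMonicOfDegree_minor (R : Type*) [CommRing R] {m n : ℕ}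
    {P : Finset (Fin m) × Finset (Fin n)} (hP : P.1.card = P.2.card) :
    IsMonicOfDegree MonomialOrder.lex
      (minor (leftFactor R m n (m + n) * rightFactor R m n (m + n)) P.1 P.2)
      (leadingExponent P) := by
  have hk : P.1.card ≤ m + n := (card_finset_fin_le P.1).trans (Nat.le_add_right m n)
  rw [minor, dif_pos hP.symm, leadingExponent, ← exponent_orderEmbOfFin _ _ rfl hk,
    ← exponent_orderEmbOfFin _ _ hP.symm hk]
  exact isMonicOfDegree_det_mul R hk _ _

theorem SubsetLE.refl {n : ℕ} (S : Finset (Fin n)) : SubsetLE S S :=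
  ⟨le_rfl, fun _ => le_rfl⟩

theorem SubsetLE.trans {n : ℕ} {S T U : Finset (Fin n)} (h : SubsetLE S T) (h' : SubsetLE T U) :
    SubsetLE S U :=
  ⟨h'.1.trans h.1, fun ν => (h.2 (Fin.castLE h'.1 ν)).trans (h'.2 ν)⟩

theorem SubsetLE.antisymm {n : ℕ} {S T : Finset (Fin n)} (h : SubsetLE S T)
    (h' : SubsetLE T S) : S = T := by
  obtain ⟨hc, hle⟩ := h
  obtain ⟨hc', hle'⟩ := h'
  ext x
  rw [← Finset.mem_coe, ← Finset.mem_coe, ← Finset.range_orderEmbOfFin S rfl,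
    ← Finset.range_orderEmbOfFin T rfl]
  constructor
  · rintro ⟨ν, rfl⟩
    exact ⟨Fin.castLE hc' ν, le_antisymm (hle' ν) (hle (Fin.castLE hc' ν))⟩
  · rintro ⟨ν, rfl⟩
    exact ⟨Fin.castLE hc ν, le_antisymm (hle ν) (hle' (Fin.castLE hc ν))⟩

/-- If every variable that occurs for `T` occurs for some set that is `≥ S`, then `S ≤ T`. -/
theorem subsetLE_of_forall_setExponent {τ : Type*} {k n : ℕ} {g : Fin k ×ₗ Fin n → τ}
    (hg : Function.Injective g) {h : n ≤ k} {S T : Finset (Fin n)}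
    (H : ∀ v, setExponent g h T v ≠ 0 → ∃ U, SubsetLE S U ∧ setExponent g h U v ≠ 0) :
    SubsetLE S T := by
  have key : ∀ ν : Fin T.card, ∃ hν : (ν : ℕ) < S.card,
      S.orderEmbOfFin rfl ⟨ν, hν⟩ ≤ T.orderEmbOfFin rfl ν := by
    intro ν
    obtain ⟨U, ⟨hc, hle⟩, hU⟩ := H _ (setExponent_apply_ne_zero.2 ⟨ν, rfl⟩)
    obtain ⟨i, hi⟩ := setExponent_apply_ne_zero.1 hU
    have hi := toLex.injective (hg hi)
    rw [Prod.mk.injEq] at hi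
    have hiν : (i : ℕ) = ν := congrArg Fin.val hi.1
    have hν : (ν : ℕ) < S.card := hiν ▸ i.2.trans_le hc
    refine ⟨hν, ?_⟩
    rw [← hi.2]
    have hcast : (⟨ν, hν⟩ : Fin S.card) = Fin.castLE hc i := Fin.ext hiν.symm
    rw [hcast]
    exact hle i
  have hcard : T.card ≤ S.card := by
    by_contra! hlt
    exact lt_irrefl _ (key ⟨S.card, hlt⟩).1
  exact ⟨hcard, fun ν => (key ν).2⟩

theorem sum_map_apply_ne_zero {ι τ : Type*} {d : ι → τ →₀ ℕ} {l : List ι} {v : τ} :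
    (l.map d).sum v ≠ 0 ↔ ∃ i ∈ l, d i v ≠ 0 := by
  induction l with
  | nil => simp
  | cons i l ih =>
    rw [List.map_cons, List.sum_cons, Finsupp.add_apply, ne_eq, add_eq_zero, not_and_or]
    simp only [List.mem_cons, exists_eq_or_imp]
    exact or_congr Iff.rfl ih

theorem leadingExponent_apply_inl {m n : ℕ} (P : Finset (Fin m) × Finset (Fin n))
    (v : Fin (m + n) ×ₗ Fin m) :
    leadingExponent P (Sum.inlₗ v) =
      setExponent (Sum.inlₗ (β := Fin (m + n) ×ₗ Fin n)) (Nat.le_add_right m n) P.1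
        (Sum.inlₗ v) := by
  rw [leadingExponent, Finsupp.add_apply, Nat.add_eq_left]
  by_contra hcon
  obtain ⟨i, hi⟩ := setExponent_apply_ne_zero.1 hcon
  exact Sum.inr_ne_inl (toLex.injective hi)

theorem leadingExponent_apply_inr {m n : ℕ} (P : Finset (Fin m) × Finset (Fin n))
    (v : Fin (m + n) ×ₗ Fin n) :
    leadingExponent P (Sum.inrₗ v) =
      setExponent (Sum.inrₗ (α := Fin (m + n) ×ₗ Fin m)) (Nat.le_add_left n m) P.2
        (Sum.inrₗ v) := by
  rw [leadingExponent, Finsupp.add_apply, Nat.add_eq_right]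
  by_contra hcon
  obtain ⟨i, hi⟩ := setExponent_apply_ne_zero.1 hcon
  exact Sum.inl_ne_inr (toLex.injective hi)

/-- The order on the factors of a standard sequence. -/
def PairLE {m n : ℕ} (P P' : Finset (Fin m) × Finset (Fin n)) : Prop :=
  SubsetLE P.1 P'.1 ∧ SubsetLE P.2 P'.2

/-- If two products of minors have the same leading monomial and the first one is standard, then its
first factor is `≤` the first factor of the second. In fact it is a lower bound for all pairs whose
variables occur in the leading monomial. -/
theorem pairLE_of_sum_eq {m n : ℕ} {P P' : Finset (Fin m) × Finset (Fin n)}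
    {l l' : List (Finset (Fin m) × Finset (Fin n))} (hl : (P :: l).Pairwise PairLE)
    (h : ((P :: l).map leadingExponent).sum = ((P' :: l').map leadingExponent).sum) :
    PairLE P P' := by
  have hP : ∀ U ∈ P :: l, PairLE P U := by
    intro U hU
    rcases List.mem_cons.1 hU with rfl | hU
    · exact ⟨SubsetLE.refl _, SubsetLE.refl _⟩
    · exact List.rel_of_pairwise_cons hl hU
  have hex : ∀ v, leadingExponent P' v ≠ 0 → ∃ U ∈ P :: l, leadingExponent U v ≠ 0 := by
    intro v hv
    rw [← sum_map_apply_ne_zero, h, sum_map_apply_ne_zero]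
    exact ⟨P', by simp, hv⟩
  constructor
  · refine subsetLE_of_forall_setExponent (g := Sum.inlₗ (β := Fin (m + n) ×ₗ Fin n))
      (h := Nat.le_add_right m n) Sum.Lex.inl_strictMono.injective ?_
    intro v hv
    obtain ⟨i, rfl⟩ := setExponent_apply_ne_zero.1 hv
    rw [← leadingExponent_apply_inl] at hv
    obtain ⟨U, hU, hUv⟩ := hex _ hv
    exact ⟨U.1, (hP U hU).1, by rwa [← leadingExponent_apply_inl]⟩
  · refine subsetLE_of_forall_setExponent (g := Sum.inrₗ (α := Fin (m + n) ×ₗ Fin m))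
      (h := Nat.le_add_left n m) Sum.Lex.inr_strictMono.injective ?_
    intro v hv
    obtain ⟨i, rfl⟩ := setExponent_apply_ne_zero.1 hv
    rw [← leadingExponent_apply_inr] at hv
    obtain ⟨U, hU, hUv⟩ := hex _ hv
    exact ⟨U.2, (hP U hU).2, by rwa [← leadingExponent_apply_inr]⟩

theorem eq_empty_of_setExponent_eq_zero {τ : Type*} {k n : ℕ} {g : Fin k ×ₗ Fin n → τ}
    {h : n ≤ k} {A : Finset (Fin n)} (hA : setExponent g h A = 0) : A = ∅ := by
  by_contra hne
  have hpos : 0 < A.card := Finset.card_pos.2 (Finset.nonempty_iff_ne_empty.2 hne)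
  exact setExponent_apply_ne_zero.2 ⟨⟨0, hpos⟩, rfl⟩ (DFunLike.congr_fun hA _)

theorem eq_empty_of_leadingExponent_eq_zero {m n : ℕ} {P : Finset (Fin m) × Finset (Fin n)}
    (hP : leadingExponent P = 0) : P = (∅, ∅) := by
  rw [leadingExponent, add_eq_zero] at hP
  exact Prod.ext (eq_empty_of_setExponent_eq_zero hP.1) (eq_empty_of_setExponent_eq_zero hP.2)

theorem list_eq_of_sum_leadingExponent_eq {m n : ℕ}
    {l l' : List (Finset (Fin m) × Finset (Fin n))} (hl : l.Pairwise PairLE)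
    (hl' : l'.Pairwise PairLE) (hne : ∀ P ∈ l, P ≠ (∅, ∅)) (hne' : ∀ P ∈ l', P ≠ (∅, ∅))
    (h : (l.map leadingExponent).sum = (l'.map leadingExponent).sum) : l = l' := by
  induction l generalizing l' with
  | nil =>
    cases l' with
    | nil => rfl
    | cons P' l' =>
      rw [List.map_cons, List.sum_cons, List.map_nil, List.sum_nil, eq_comm, add_eq_zero] at h
      exact absurd (eq_empty_of_leadingExponent_eq_zero h.1) (hne' P' (by simp))
  | cons P l ih =>
    cases l' with
    | nil =>
      rw [List.map_cons, List.sum_cons, List.map_nil, List.sum_nil, add_eq_zero] at h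
      exact absurd (eq_empty_of_leadingExponent_eq_zero h.1) (hne P (by simp))
    | cons P' l' =>
      have h1 := pairLE_of_sum_eq hl h
      have h2 := pairLE_of_sum_eq hl' h.symm
      have hPP : P = P' := Prod.ext (h1.1.antisymm h2.1) (h1.2.antisymm h2.2)
      subst hPP
      rw [List.map_cons, List.sum_cons, List.map_cons, List.sum_cons, add_right_inj] at h
      rw [ih hl.of_cons hl'.of_cons (fun Q hQ => hne Q (by simp [hQ]))
        (fun Q hQ => hne' Q (by simp [hQ])) h]

/-! ### Standard monomials -/

theorem StandardSeq.pairwise_nonemptyFactors {m n : ℕ} (s : StandardSeq m n) :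
    s.nonemptyFactors.Pairwise PairLE := by
  have hr : (s.factors.map Prod.fst).Pairwise SubsetLE :=
    haveI : IsTrans (Finset (Fin m)) SubsetLE := ⟨fun _ _ _ => SubsetLE.trans⟩
    List.isChain_iff_pairwise.1 s.rows_le
  have hc : (s.factors.map Prod.snd).Pairwise SubsetLE :=
    haveI : IsTrans (Finset (Fin n)) SubsetLE := ⟨fun _ _ _ => SubsetLE.trans⟩
    List.isChain_iff_pairwise.1 s.cols_le
  exact ((List.pairwise_map.1 hr).and (List.pairwise_map.1 hc)).sublist List.filter_sublist

/-- The list of the factors other than `(∅|∅)`, as a function of the standard monomial. -/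
def StandardMonomial.factors {m n : ℕ} :
    StandardMonomial m n → List (Finset (Fin m) × Finset (Fin n)) :=
  Quotient.lift StandardSeq.nonemptyFactors fun _ _ h => h

theorem StandardMonomial.injective_sum_leadingExponent {m n : ℕ} :
    Function.Injective
      fun M : StandardMonomial m n => (M.factors.map leadingExponent).sum := by
  intro M M' h
  induction M using Quotient.inductionOn with | _ s
  induction M' using Quotient.inductionOn with | _ t
  refine Quotient.sound (list_eq_of_sum_leadingExponent_eq s.pairwise_nonemptyFactors
    t.pairwise_nonemptyFactors ?_ ?_ h)
  · intro P hP
    simpa using (List.mem_filter.1 hP).2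
  · intro P hP
    simpa using (List.mem_filter.1 hP).2

theorem StandardMonomial.isMonicOfDegree_eval (R : Type*) [CommRing R] {m n : ℕ}
    (M : StandardMonomial m n) :
    IsMonicOfDegree MonomialOrder.lex
      (M.eval (leftFactor R m n (m + n) * rightFactor R m n (m + n)))
      (M.factors.map leadingExponent).sum := by
  induction M using Quotient.inductionOn with | _ s
  change IsMonicOfDegree _ (s.eval _) (s.nonemptyFactors.map leadingExponent).sum
  rw [StandardSeq.eval_eq]
  exact IsMonicOfDegree.list_prod _ fun P hP =>
    isMonicOfDegree_minor R (s.card_eq P (List.mem_filter.1 hP).1)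

theorem map_minor {m n : ℕ} {K L : Type*} [CommRing K] [CommRing L] (φ : K →+* L)
    (X : Matrix (Fin m) (Fin n) K) (A : Finset (Fin m)) (B : Finset (Fin n)) :
    φ (minor X A B) = minor (X.map φ) A B := by
  unfold minor
  split_ifs with h
  · rw [RingHom.map_det]
    rfl
  · exact map_zero φ

theorem StandardMonomial.map_eval {m n : ℕ} {K L : Type*} [CommRing K] [CommRing L] (φ : K →+* L)
    (X : Matrix (Fin m) (Fin n) K) (M : StandardMonomial m n) :
    φ (M.eval X) = M.eval (X.map φ) := by
  induction M using Quotient.inductionOn with | _ s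
  change φ (s.eval X) = s.eval (X.map φ)
  simp only [StandardSeq.eval, map_list_prod, List.map_map, Function.comp_def, map_minor]

end Straightening

theorem theorem4 {R : Type*} [CommRing R] {σ : Type*} {m n : ℕ}
    (X : Matrix (Fin m) (Fin n) (MvPolynomial σ R)) (hX : Straightening.IsGeneric X) :
    LinearIndependent R
      (fun M : Straightening.StandardMonomial m n => Straightening.StandardMonomial.eval X M) := by
  obtain ⟨x, hx, hXx⟩ := hX
  let Y := Straightening.leftFactor R m n (m + n) * Straightening.rightFactor R m n (m + n)
  -- the substitution `X ↦ P * Q`; indeterminates outside the matrix go to `0`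
  let φ := MvPolynomial.aeval (R := R) (Function.extend x (fun ij => Y ij.1 ij.2) 0)
  have hφ : X.map φ.toRingHom = Y := by
    ext1 i j
    change φ (X i j) = _
    rw [hXx, MvPolynomial.aeval_X, hx.extend_apply]
  refine LinearIndependent.of_comp φ.toLinearMap ?_
  have hcomp : (φ.toLinearMap ∘ fun M : Straightening.StandardMonomial m n => M.eval X) =
      fun M => M.eval Y := by
    funext M
    rw [← hφ]
    exact M.map_eval φ.toRingHom X
  rw [hcomp]
  exact Straightening.IsMonicOfDegree.linearIndependent
    (fun M => M.isMonicOfDegree_eval R)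
    Straightening.StandardMonomial.injective_sum_leadingExponent
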